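/- Let $\Sigma$ be a set of program states. An Aczel trace is an initial state followed either by an infinite sequence of transitions, or by a finite sequence of transitions together with an outcome (terminated, aborted or incomplete); each transition is labelled $\pi$ (program) or $\epsilon$ (environment), starts in the state reached so far and ends in its post-state. A command is a set of traces that contains, for every initial state, the incomplete trace without transitions, that contains every finite initial sequence of transitions of its traces as an incomplete trace, and that contains every trace extending one of its aborted traces. Commands are ordered by $c \succeq d$ ($c$ is refined by $d$) iff the traces of $d$ are traces of $c$; this is a complete lattice with joins $\vee,\bigvee$, and its greatest command is $\lightning$ (abort). For $p\subseteq\Sigma$ the test $\tau(p)$ terminates immediately from states in $p$ and is infeasible (it has only the incomplete trace without transitions) from other states. For $r\subseteq\Sigma\times\Sigma$ the command $\pi(r)$ (respectively $\epsilon(r)$) performs a single program (environment) transition in $r$ and terminates, and it is infeasible from states outside the domain of $r$. The traces of $c\,;d$ are the traces of $c$ that are not terminated, the terminated traces of $c$ continued by a trace of $d$ from the state reached, and all extensions of aborted traces of $c$. The traces of the weak conjunction $c \Cap d$ are the common traces of $c$ and $d$, and all extensions of a finite sequence of transitions that is an aborted trace of one of $c,d$ and an incomplete trace of the other. Sequential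 composition binds more tightly than $\Cap$, and $\Cap$ more tightly than $\vee$. Let $c^\star$ and $c^\omega$ be the least and the greatest fixed point of $y \mapsto \tau(\Sigma)\vee c\,;y$, let $\mathsf{univ}=\Sigma\times\Sigma$, let an overline denote complement, and let \[ \begin{aligned} \{p\} &= \tau(\Sigma)\vee\tau(\overline{p})\,;\lightning, & \alpha(r) &= \pi(r)\vee\epsilon(r),\\ \mathbf{guar}\,g &= (\pi(g)\vee\epsilon(\mathsf{univ}))^\omega, & \mathbf{rely}\,r &= (\alpha(\mathsf{univ})\vee\epsilon(\overline{r})\,;\lightning)^\omega,\\ \mathbf{term} &= \alpha(\mathsf{univ})^\star\,;\epsilon(\mathsf{univ})^\omega, & [q] &= \bigvee_{\sigma_0\in\Sigma}\tau(\{\sigma_0\})\,;\mathbf{term}\,;\tau(\{\sigma : (\sigma_0,\sigma)\in q\}). \end{aligned} \] For $p \subseteq\Sigma$ let $\mathrm{pre}\,p=\{(\sigma_0,\sigma) : \sigma_0\in p\}$ and $\mathrm{post}\,p=\{(\sigma_0,\sigma) : \sigma\in p\}$. For $I\subseteq\Sigma$ let $\mathbf{inv}\,I=\{I\}\,;\alpha(\mathrm{post}\,I)^\omega$.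 A command $c$ is data-reified by $d$ under the coupling invariant $I$ if $\mathbf{inv}\,I\Cap c\succeq\mathbf{inv}\,I\Cap d$. **Lemma.** Let $I,p_1,p_2\subseteq\Sigma$ and $r_1,r_2,g_1,g_2,q_1,q_2\subseteq\Sigma\times\Sigma$ satisfy \[ I\cap p_1\subseteq p_2,\qquad \mathrm{pre}\,I\cap r_1\cap\mathrm{post}\,I\subseteq r_2,\qquad g_1\supseteq\mathrm{pre}\,I\cap g_2\cap\mathrm{post}\,I,\qquad q_1\supseteq\mathrm{pre}\,I\cap\mathrm{pre}\,p_1\cap q_2\cap\mathrm{post}\,I. \] Then $\mathbf{rely}\,r_1\Cap\mathbf{guar}\,g_1\Cap\{p_1\}\,;[q_1]$ is data-reified under $I$ by $\mathbf{rely}\,r_2\Cap\mathbf{guar}\,g_2\Cap\{p_2\}\,;[q_2]$. -/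

import Mathlib

namespace RelyGuarantee

/-! ### Aczel traces over a set `S` of program states -/

/-- A transition is made either by the program (`π`) or by its environment (`ε`). -/
inductive Label : Type
  | prog
  | env

/-- A transition, given by its label and its post-state; its pre-state is the post-state of the
preceding transition, or the initial state of the trace if there is none. -/
abbrev Transition (S : Type*) := Label × S

/-- A finite sequence of transitions ends in termination, in (irrecoverable) failure, or it is
incomplete: a finite observation that is not claimed to be a whole execution. -/
inductive Outcome : Type
  | terminated
  | aborted
  | incomplete

/-- An Aczel trace: an initial state followed by a finite sequence of transitions with an outcome,
or by an infinite sequence of transitions. -/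
inductive Trace (S : Type*)
  | fin (σ : S) (l : List (Transition S)) (o : Outcome)
  | inf (σ : S) (f : Stream' (Transition S))

/-- The initial state of a trace. -/
def Trace.first {S : Type*} : Trace S → S
  | .fin σ _ _ => σ
  | .inf σ _ => σ

/-- The state reached from `σ` by the transitions `l`. -/
def endState {S : Type*} (σ : S) : List (Transition S) → S
  | [] => σ
  | a :: l => endState a.2 l

/-- The trace that starts in `σ`, makes the transitions `l` and then those of `t`
(used when `t` starts in `endState σ l`). -/
def Trace.prepend {S : Type*} (σ : S) (l : List (Transition S)) : Trace S → Trace S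
  | .fin _ l' o => .fin σ (l ++ l') o
  | .inf _ f => .inf σ (Stream'.appendStream' l f)

/-- `t` starts in `σ` and its first transitions are `l`. -/
def Trace.Extends {S : Type*} (t : Trace S) (σ : S) (l : List (Transition S)) : Prop :=
  ∃ u : Trace S, u.first = endState σ l ∧ t = u.prepend σ l

theorem endState_append {S : Type*} (σ : S) (l m : List (Transition S)) :
    endState σ (l ++ m) = endState (endState σ l) m := by
  induction l generalizing σ with
  | nil => rfl
  | cons a l ih => exact ih a.2

theorem Trace.first_prepend {S : Type*} (σ : S) (l : List (Transition S)) (t : Trace S) :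
    (t.prepend σ l).first = σ := by
  cases t <;> rfl

theorem Trace.prepend_prepend {S : Type*} (σ σ' : S) (l m : List (Transition S)) (t : Trace S) :
    (t.prepend σ' m).prepend σ l = t.prepend σ (l ++ m) := by
  cases t <;> simp [Trace.prepend]

theorem Trace.prepend_nil {S : Type*} (t : Trace S) : t.prepend t.first [] = t := by
  cases t <;> simp [Trace.prepend, Trace.first]

theorem Trace.extends_self {S : Type*} (σ : S) (l : List (Transition S)) (o : Outcome) :
    (Trace.fin σ l o).Extends σ l :=
  ⟨.fin (endState σ l) [] o, rfl, by simp [Trace.prepend]⟩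

theorem Trace.Extends.trans {S : Type*} {t : Trace S} {σ σ' : S} {l m : List (Transition S)}
    {o : Outcome} (h : t.Extends σ' m) (h' : (Trace.fin σ' m o).Extends σ l) :
    t.Extends σ l := by
  obtain ⟨u, hu, rfl⟩ := h
  obtain ⟨v, hv, h'⟩ := h'
  cases v with
  | inf s f => simp [Trace.prepend] at h'
  | fin s k o' =>
    simp only [Trace.prepend, Trace.fin.injEq] at h'
    obtain ⟨rfl, rfl, rfl⟩ := h'
    refine ⟨u.prepend (endState σ' l) k, Trace.first_prepend _ _ _, ?_⟩
    rw [Trace.prepend_prepend]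

/-- Two finite sequences of transitions that a trace starts with are comparable. -/
theorem Trace.Extends.comparable {S : Type*} {t : Trace S} {σ σ' : S}
    {l m : List (Transition S)} (h : t.Extends σ l) (h' : t.Extends σ' m) :
    σ = σ' ∧ ((∀ o, (Trace.fin σ l o).Extends σ m) ∨ ∀ o, (Trace.fin σ m o).Extends σ l) := by
  obtain ⟨u, hu, rfl⟩ := h
  obtain ⟨v, hv, h'⟩ := h'
  have key : ∀ a b : List (Transition S), a <+: b → ∀ o, (Trace.fin σ b o).Extends σ a := by
    rintro a b ⟨k, rfl⟩ o
    exact ⟨.fin (endState σ a) k o, rfl, rfl⟩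
  cases u <;> cases v <;> simp only [Trace.prepend, Trace.fin.injEq, Trace.inf.injEq,
    reduceCtorEq] at h'
  · obtain ⟨rfl, h', -⟩ := h'
    refine ⟨rfl, ?_⟩
    rcases List.prefix_or_prefix_of_prefix (List.prefix_append l _)
      (h' ▸ List.prefix_append m _) with h | h
    · exact .inr (key _ _ h)
    · exact .inl (key _ _ h)
  · rename_i f _ g
    obtain ⟨rfl, h'⟩ := h'
    refine ⟨rfl, ?_⟩
    have hl : l = Stream'.take l.length (Stream'.appendStream' l f) := by
      simp [Stream'.take_append_of_le_length]
    have hm : m = Stream'.take m.length (Stream'.appendStream' l f) := by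
      rw [h']; simp [Stream'.take_append_of_le_length]
    rcases le_total l.length m.length with h | h
    · refine .inr (key _ _ ?_)
      rw [hl, hm]
      exact Stream'.take_prefix_take_left _ _ _ h
    · refine .inl (key _ _ ?_)
      rw [hl, hm]
      exact Stream'.take_prefix_take_left _ _ _ h

/-! ### Commands -/

/-- A command is a set of traces that contains, for every initial state, the empty observation,
is closed under taking finite observations, and, once it may fail, allows any continuation. -/
@[ext] structure Command (S : Type*) where
  traces : Set (Trace S)
  initial : ∀ σ : S, Trace.fin σ [] .incomplete ∈ traces
  prefix_closed : ∀ (t : Trace S) (σ : S) (l : List (Transition S)),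
    t ∈ traces → t.Extends σ l → Trace.fin σ l .incomplete ∈ traces
  abort_closed : ∀ (t : Trace S) (σ : S) (l : List (Transition S)),
    Trace.fin σ l .aborted ∈ traces → t.Extends σ l → t ∈ traces

variable {S : Type*}

theorem Trace.extends_nil_iff {t : Trace S} {σ : S} : t.Extends σ [] ↔ t.first = σ := by
  constructor
  · rintro ⟨u, hu, rfl⟩
    exact Trace.first_prepend _ _ _
  · rintro rfl
    exact ⟨t, rfl, t.prepend_nil.symm⟩

theorem Trace.extends_nil_state {σ σ' : S} {o : Outcome} {l : List (Transition S)}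
    (h : (Trace.fin σ [] o).Extends σ' l) : σ' = σ ∧ l = [] := by
  obtain ⟨u, -, h⟩ := h
  cases u <;> simp [Trace.prepend] at h
  exact ⟨h.1.symm, h.2.1.1⟩

/-- Commands are ordered by inclusion of their sets of traces: `d ≤ c` says that `c` is refined
(implemented) by `d`. -/
instance : PartialOrder (Command S) where
  le d c := d.traces ⊆ c.traces
  le_refl c := Set.Subset.refl c.traces
  le_trans _ _ _ h h' := Set.Subset.trans h h'
  le_antisymm _ _ h h' := Command.ext (Set.Subset.antisymm h h')

/-- The complete lattice of commands: joins (nondeterministic choice) are unions, meets (strong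
conjunction) are intersections. The least command has only the empty observations, which belong
to every command, and the greatest command has all traces. -/
instance : CompleteLattice (Command S) where
  sup c d :=
    { traces := c.traces ∪ d.traces
      initial := fun σ => .inl (c.initial σ)
      prefix_closed := fun t σ l h e =>
        h.imp (fun h => c.prefix_closed t σ l h e) (fun h => d.prefix_closed t σ l h e)
      abort_closed := fun t σ l h e =>
        h.imp (fun h => c.abort_closed t σ l h e) (fun h => d.abort_closed t σ l h e) }
  le_sup_left _ _ _ h := .inl h
  le_sup_right _ _ _ h := .inr h
  sup_le _ _ _ h h' _ ht := ht.elim (fun ht => h ht) (fun ht => h' ht)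
  inf c d :=
    { traces := c.traces ∩ d.traces
      initial := fun σ => ⟨c.initial σ, d.initial σ⟩
      prefix_closed := fun t σ l h e =>
        ⟨c.prefix_closed t σ l h.1 e, d.prefix_closed t σ l h.2 e⟩
      abort_closed := fun t σ l h e =>
        ⟨c.abort_closed t σ l h.1 e, d.abort_closed t σ l h.2 e⟩ }
  inf_le_left _ _ _ h := h.1
  inf_le_right _ _ _ h := h.2
  le_inf _ _ _ h h' _ ht := ⟨h ht, h' ht⟩
  top :=
    { traces := Set.univ
      initial := fun _ => trivial
      prefix_closed := fun _ _ _ _ _ => trivial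
      abort_closed := fun _ _ _ _ _ => trivial }
  le_top _ _ _ := trivial
  bot :=
    { traces := {t | ∃ σ, t = .fin σ [] .incomplete}
      initial := fun σ => ⟨σ, rfl⟩
      prefix_closed := by
        rintro t σ l ⟨σ', rfl⟩ e
        obtain ⟨rfl, rfl⟩ := Trace.extends_nil_state e
        exact ⟨_, rfl⟩
      abort_closed := by
        rintro t σ l ⟨σ', h⟩ e
        simp at h }
  bot_le c := by
    rintro t ⟨σ, rfl⟩
    exact c.initial σ
  sSup C :=
    { traces := {t | (∃ σ, t = .fin σ [] .incomplete) ∨ ∃ c ∈ C, t ∈ c.traces}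
      initial := fun σ => .inl ⟨σ, rfl⟩
      prefix_closed := by
        rintro t σ l (⟨σ', rfl⟩ | ⟨c, hc, h⟩) e
        · obtain ⟨rfl, rfl⟩ := Trace.extends_nil_state e
          exact .inl ⟨_, rfl⟩
        · exact .inr ⟨c, hc, c.prefix_closed t σ l h e⟩
      abort_closed := by
        rintro t σ l (⟨σ', h⟩ | ⟨c, hc, h⟩) e
        · simp at h
        · exact .inr ⟨c, hc, c.abort_closed t σ l h e⟩ }
  isLUB_sSup C := by
    constructor
    · intro c hc t ht
      exact .inr ⟨c, hc, ht⟩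
    · rintro d hd t (⟨σ, rfl⟩ | ⟨c, hc, h⟩)
      · exact d.initial σ
      · exact hd hc h
  sInf C :=
    { traces := {t | ∀ c ∈ C, t ∈ c.traces}
      initial := fun σ c _ => c.initial σ
      prefix_closed := fun t σ l h e c hc => c.prefix_closed t σ l (h c hc) e
      abort_closed := fun t σ l h e c hc => c.abort_closed t σ l (h c hc) e }
  isGLB_sInf C := by
    constructor
    · intro c hc t ht
      exact ht c hc
    · intro d hd t ht c hc
      exact hd hc ht

/-! ### Primitive commands and operators -/

/-- The instantaneous test of `p`: a no-op from states in `p`, infeasible from other states. -/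
def test (p : Set S) : Command S where
  traces := {t | ∃ σ, t = .fin σ [] .incomplete ∨ σ ∈ p ∧ t = .fin σ [] .terminated}
  initial σ := ⟨σ, .inl rfl⟩
  prefix_closed := by
    rintro t σ l ⟨σ', rfl | ⟨-, rfl⟩⟩ e <;> obtain ⟨rfl, rfl⟩ := Trace.extends_nil_state e <;>
      exact ⟨_, .inl rfl⟩
  abort_closed := by
    rintro t σ l ⟨σ', h | ⟨-, h⟩⟩ e <;> simp at h

/-- A single transition with label `k` that satisfies the relation `r`. -/
def atomic (k : Label) (r : Set (S × S)) : Command S where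
  traces := {t | ∃ σ, t = .fin σ [] .incomplete ∨
    ∃ σ', (σ, σ') ∈ r ∧
      (t = .fin σ [(k, σ')] .incomplete ∨ t = .fin σ [(k, σ')] .terminated)}
  initial σ := ⟨σ, .inl rfl⟩
  prefix_closed := by
    rintro t σ l ⟨s, rfl | ⟨s', hr, h⟩⟩ e
    · obtain ⟨rfl, rfl⟩ := Trace.extends_nil_state e
      exact ⟨_, .inl rfl⟩
    · obtain ⟨u, -, rfl⟩ := e
      cases u with
      | inf _ f => simp [Trace.prepend] at h
      | fin _ l' o =>
        have h : σ = s ∧ l ++ l' = [(k, s')] := by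
          rcases h with h | h <;> simp only [Trace.prepend, Trace.fin.injEq] at h <;>
            exact ⟨h.1, h.2.1⟩
        obtain ⟨rfl, hl⟩ := h
        rcases l with _ | ⟨a, l⟩
        · exact ⟨σ, .inl rfl⟩
        · simp only [List.cons_append, List.cons.injEq, List.append_eq_nil_iff] at hl
          obtain ⟨rfl, rfl, -⟩ := hl
          exact ⟨σ, .inr ⟨s', hr, .inl rfl⟩⟩
  abort_closed := by
    rintro t σ l ⟨s, h | ⟨s', -, h | h⟩⟩ e <;> simp at h

/-- The command that may perform a program transition satisfying `r`. -/
def progStep (r : Set (S × S)) : Command S := atomic .prog r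

/-- The command that may perform an environment transition satisfying `r`. -/
def envStep (r : Set (S × S)) : Command S := atomic .env r

/-- Dijkstra's abort command, the greatest command. -/
def abort : Command S := ⊤

/-- Sequential composition: a trace of `c` that has not terminated, a terminated trace of `c`
followed by a trace of `d`, or any continuation of a failing trace of `c`. -/
def seq (c d : Command S) : Command S where
  traces := {t | (t ∈ c.traces ∧ ∀ σ l, t ≠ .fin σ l .terminated) ∨
    (∃ σ l, .fin σ l .terminated ∈ c.traces ∧
      ∃ u ∈ d.traces, u.first = endState σ l ∧ t = u.prepend σ l) ∨
    ∃ σ l, .fin σ l .aborted ∈ c.traces ∧ t.Extends σ l}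
  initial σ := .inl ⟨c.initial σ, by simp⟩
  prefix_closed := by
    rintro t σ l (⟨h, -⟩ | ⟨s, m, h, u, hu, hf, rfl⟩ | ⟨s, m, h, e'⟩) e
    · exact .inl ⟨c.prefix_closed t σ l h e, by simp⟩
    · obtain ⟨rfl, H | H⟩ := Trace.Extends.comparable e ⟨u, hf, rfl⟩
      · obtain ⟨v, hv, h'⟩ := H .incomplete
        cases v with
        | inf _ f => simp [Trace.prepend] at h'
        | fin s' k o =>
          simp only [Trace.prepend, Trace.fin.injEq] at h'
          obtain ⟨-, rfl, rfl⟩ := h'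
          change s' = endState σ m at hv
          subst hv
          refine .inr (.inl ⟨σ, m, h, .fin (endState σ m) k .incomplete, ?_, rfl, rfl⟩)
          refine d.prefix_closed u _ _ hu ?_
          obtain ⟨w, hw, e⟩ := e
          rw [endState_append] at hw
          refine ⟨w, hw, ?_⟩
          cases u <;> cases w <;>
            simp only [Trace.prepend, Trace.fin.injEq, Trace.inf.injEq, reduceCtorEq, true_and,
              List.append_assoc, List.append_cancel_left_eq, Stream'.append_append_stream,
              Stream'.append_right_inj, Trace.first] at e hf ⊢
          · exact ⟨hf, e⟩
          · exact ⟨hf, e⟩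
      · exact .inl ⟨c.prefix_closed _ σ l h (H _), by simp⟩
    · obtain ⟨rfl, H | H⟩ := Trace.Extends.comparable e e'
      · exact .inr (.inr ⟨_, m, h, H _⟩)
      · exact .inl ⟨c.prefix_closed _ _ l h (H _), by simp⟩
  abort_closed := by
    rintro t σ l (⟨h, -⟩ | ⟨s, m, h, u, hu, hf, h'⟩ | ⟨s, m, h, e'⟩) e
    · exact .inr (.inr ⟨σ, l, h, e⟩)
    · refine .inr (.inl ⟨s, m, h, ?_⟩)
      cases u with
      | inf _ f => simp [Trace.prepend] at h'
      | fin s' k o =>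
        simp only [Trace.prepend, Trace.fin.injEq] at h'
        obtain ⟨rfl, rfl, rfl⟩ := h'
        change s' = endState σ m at hf
        subst hf
        obtain ⟨v, hv, rfl⟩ := e
        rw [endState_append] at hv
        exact ⟨v.prepend (endState σ m) k, d.abort_closed _ _ _ hu ⟨v, hv, rfl⟩,
          Trace.first_prepend _ _ _, (Trace.prepend_prepend _ _ _ _ _).symm⟩
    · exact .inr (.inr ⟨s, m, h, e.trans e'⟩)

/-- Weak conjunction: the common traces of `c` and `d`, and any continuation of a finite sequence
of transitions after which one of them fails while the other can perform these transitions. -/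
def conj (c d : Command S) : Command S where
  traces := {t | (t ∈ c.traces ∧ t ∈ d.traces) ∨
    ∃ σ l, t.Extends σ l ∧
      ((.fin σ l .aborted ∈ c.traces ∧ .fin σ l .incomplete ∈ d.traces) ∨
       (.fin σ l .incomplete ∈ c.traces ∧ .fin σ l .aborted ∈ d.traces))}
  initial σ := .inl ⟨c.initial σ, d.initial σ⟩
  prefix_closed := by
    rintro t σ l (⟨h, h'⟩ | ⟨s, m, e', h⟩) e
    · exact .inl ⟨c.prefix_closed t σ l h e, d.prefix_closed t σ l h' e⟩
    · obtain ⟨rfl, H | H⟩ := Trace.Extends.comparable e e'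
      · exact .inr ⟨_, m, H _, h⟩
      · refine .inl ?_
        rcases h with ⟨h, h'⟩ | ⟨h, h'⟩ <;>
          exact ⟨c.prefix_closed _ _ l h (H _), d.prefix_closed _ _ l h' (H _)⟩
  abort_closed := by
    rintro t σ l (⟨h, h'⟩ | ⟨s, m, e', h⟩) e
    · exact .inl ⟨c.abort_closed t σ l h e, d.abort_closed t σ l h' e⟩
    · exact .inr ⟨s, m, e.trans e', h⟩

infixr:75 " ⨟ " => seq

infixl:66 " ⋒ " => conj

theorem seq_mono_right (c : Command S) : Monotone (seq c) := by
  rintro d d' h t (ht | ⟨σ, l, hc, u, hu, ht⟩ | ht)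
  · exact .inl ht
  · exact .inr (.inl ⟨σ, l, hc, u, h hu, ht⟩)
  · exact .inr (.inr ht)

/-! ### Derived commands -/

/-- The test that always succeeds. -/
def nil : Command S := test Set.univ

/-- The assertion of `p`: aborts if the current state is not in `p`, otherwise a no-op. -/
def assertion (p : Set S) : Command S := nil ⊔ test pᶜ ⨟ abort

/-- A program or environment transition that satisfies `r`. -/
def step (r : Set (S × S)) : Command S := progStep r ⊔ envStep r

/-- Any program transition. -/
def anyProgStep : Command S := progStep Set.univ

/-- Any environment transition. -/
def anyEnvStep : Command S := envStep Set.univ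

/-- Any transition. -/
def anyStep : Command S := step Set.univ

/-- The function `y ↦ nil ∨ c ; y` on commands. -/
def iterFun (c : Command S) : Command S →o Command S where
  toFun y := nil ⊔ c ⨟ y
  monotone' _ _ h := sup_le_sup_left (seq_mono_right c h) _

/-- Finite iteration. -/
def finIter (c : Command S) : Command S := OrderHom.lfp (iterFun c)

/-- Possibly infinite iteration. -/
def iter (c : Command S) : Command S := OrderHom.gfp (iterFun c)

/-- Program guarantee: every program transition satisfies `g`. -/
def guar (g : Set (S × S)) : Command S := iter (progStep g ⊔ anyEnvStep)

/-- Rely: assumes that environment transitions satisfy `r`, aborts if one does not. -/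
def rely (r : Set (S × S)) : Command S := iter (anyStep ⊔ envStep rᶜ ⨟ abort)

/-- Finitely many program transitions; the environment is not constrained. -/
def term : Command S := finIter anyStep ⨟ iter anyEnvStep

/-- Postcondition specification: terminates in a state related to the initial state by `q`. -/
def spec (q : Set (S × S)) : Command S :=
  ⨆ σ₀ : S, test {σ₀} ⨟ term ⨟ test {σ | (σ₀, σ) ∈ q}

/-! ### Invariants and data reification -/

/-- The pairs of states whose initial state is in `p`. -/
def preRel (p : Set S) : Set (S × S) := {x | x.1 ∈ p}

/-- The pairs of states whose final state is in `p`. -/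
def postRel (p : Set S) : Set (S × S) := {x | x.2 ∈ p}

/-- Every transition, program or environment, satisfies `r`. -/
def promise (r : Set (S × S)) : Command S := iter (step r)

/-- The command that establishes `I` by every transition, assuming the initial state is in `I`. -/
def inv (I : Set S) : Command S := assertion I ⨟ promise (postRel I)

/-- `DataReifies I c d`: `d` is a data reification of `c` under the coupling invariant `I`. -/
def DataReifies (I : Set S) (c d : Command S) : Prop := inv I ⋒ d ≤ inv I ⋒ c

end RelyGuarantee

open RelyGuarantee

namespace RelyGuarantee

variable {S : Type*}

/-! ### Steps of traces -/

/-! The inclusion is checked trace by trace. From an initial state outside `I` the invariant fails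
at once, and from one outside `p₁` the assertion of the abstract command does; in both cases the
abstract side allows every trace. Otherwise the initial state lies in `p₂` as well, so all
assertions are transparent, and what the remaining commands do can be read off directly.

From `I`, `inv I` has only non-failing traces whose states stay in `I` (`mem_inv`). A guarantee has
the non-failing traces whose program transitions satisfy it (`mem_guar_iff`). A specification never
fails, admits every incomplete trace, and constrains only terminated traces through `q`
(`mem_spec_of_mem_spec`). A rely admits every non-failing trace and fails only after an environment
transition outside its relation (`exists_of_aborted_mem_rely`).

So a trace of the reified command has one of two forms. If it is a common trace of guarantee and
specification, its states lie in `I`, and the inclusions for `g` and `q` move it to the abstract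
command. If it breaks `r₂`, the offending transition joins states of `I`, hence breaks `r₁` too. The
abstract rely then fails at the same point, which its other conjuncts can also reach, and any
continuation is allowed. -/

theorem Trace.Extends.first_eq {t : Trace S} {σ : S} {l : List (Transition S)}
    (h : t.Extends σ l) : t.first = σ := by
  obtain ⟨u, -, rfl⟩ := h
  exact Trace.first_prepend _ _ _

theorem Trace.extends_append_fin (σ : S) (l m : List (Transition S)) (o : Outcome) :
    (Trace.fin σ (l ++ m) o).Extends σ l :=
  ⟨.fin (endState σ l) m o, rfl, rfl⟩

theorem Trace.Extends.of_append {t : Trace S} {σ : S} {l m : List (Transition S)}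
    (h : t.Extends σ (l ++ m)) : t.Extends σ l :=
  h.trans (Trace.extends_append_fin σ l m .incomplete)

/-- Peels one transition off a trace and off an observed prefix simultaneously, for finite and
infinite traces alike; the inductions on prefixes rest on it. -/
theorem Trace.prepend_singleton_extends_cons {u : Trace S} {σ σ' : S} {b a : Transition S}
    {l : List (Transition S)} (hu : u.first = b.2) :
    (u.prepend σ [b]).Extends σ' (a :: l) ↔ σ = σ' ∧ b = a ∧ u.Extends b.2 l := by
  constructor
  · rintro ⟨v, hv, h⟩
    cases u <;> cases v <;>
      simp only [Trace.prepend, Trace.fin.injEq, Trace.inf.injEq, reduceCtorEq, Trace.first,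
        List.cons_append, List.nil_append, List.cons.injEq, Stream'.cons_append_stream,
        Stream'.nil_append_stream] at h hu
    · obtain ⟨rfl, ⟨rfl, rfl⟩, rfl⟩ := h
      subst hu
      exact ⟨rfl, rfl, _, hv, rfl⟩
    · obtain ⟨rfl, h⟩ := h
      obtain ⟨rfl, rfl⟩ := Stream'.cons_injective2 h
      subst hu
      exact ⟨rfl, rfl, _, hv, rfl⟩
  · rintro ⟨rfl, rfl, v, hv, rfl⟩
    exact ⟨v, hv, by rw [Trace.prepend_prepend]; rfl⟩

/-- A trace other than a finite one without transitions splits off its first transition. -/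
theorem Trace.eq_nil_or_prepend (t : Trace S) :
    (∃ σ o, t = .fin σ [] o) ∨ ∃ (σ : S) (a : Transition S) (u : Trace S),
      u.first = a.2 ∧ t = u.prepend σ [a] := by
  rcases t with ⟨σ, _ | ⟨a, l⟩, o⟩ | ⟨σ, f⟩
  · exact .inl ⟨σ, o, rfl⟩
  · exact .inr ⟨σ, a, .fin a.2 l o, rfl, rfl⟩
  · refine .inr ⟨σ, f.head, .inf f.head.2 f.tail, rfl, ?_⟩
    simp [Trace.prepend, Stream'.cons_append_stream, Stream'.nil_append_stream, Stream'.eta]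

/-- Every transition of the trace, taken with its pre-state, satisfies `R`. -/
def Trace.Steps (R : S → Transition S → Prop) (t : Trace S) : Prop :=
  ∀ σ l a, t.Extends σ (l ++ [a]) → R (endState σ l) a

/-- The trace does not end in failure. -/
def Trace.NonAborted (t : Trace S) : Prop := ∀ σ l, t ≠ .fin σ l .aborted

theorem Trace.Steps.of_extends {R : S → Transition S → Prop} {t : Trace S} {σ : S}
    {l : List (Transition S)} {o : Outcome} (h : t.Steps R) (e : t.Extends σ l) :
    (Trace.fin σ l o).Steps R :=
  fun _ _ _ e' => h _ _ _ (e.trans e')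

theorem Trace.steps_true (t : Trace S) : t.Steps fun _ _ => True := fun _ _ _ _ => trivial

theorem Trace.steps_prepend_singleton {R : S → Transition S → Prop} {u : Trace S} {σ : S}
    {b : Transition S} (hu : u.first = b.2) :
    (u.prepend σ [b]).Steps R ↔ R σ b ∧ u.Steps R := by
  constructor
  · refine fun h => ⟨h σ [] b ⟨u, hu, rfl⟩, fun σ' l a e => ?_⟩
    obtain rfl : b.2 = σ' := hu.symm.trans e.first_eq
    exact h σ (b :: l) a ((Trace.prepend_singleton_extends_cons hu).2 ⟨rfl, rfl, e⟩)
  · rintro ⟨h, h'⟩ σ' (_ | ⟨c, l⟩) a e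
    · obtain ⟨rfl, rfl, -⟩ := (Trace.prepend_singleton_extends_cons hu).1 e
      exact h
    · obtain ⟨rfl, rfl, e'⟩ := (Trace.prepend_singleton_extends_cons hu).1 e
      exact h' b.2 l a e'

theorem Trace.steps_nil {R : S → Transition S → Prop} (σ : S) (o : Outcome) :
    (Trace.fin σ [] o).Steps R := by
  intro σ' l a e
  simpa using (Trace.extends_nil_state e).2

theorem Trace.nonAborted_prepend {u : Trace S} {σ : S} {l : List (Transition S)}
    (h : (u.prepend σ l).NonAborted) : u.NonAborted := by
  rintro s k rfl
  exact h _ _ rfl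

/-- The trace makes an environment transition outside `r`, and the transitions up to that one
are possible for `c`. -/
def Trace.Violates (r : Set (S × S)) (c : Command S) (t : Trace S) : Prop :=
  ∃ σ l s, t.Extends σ (l ++ [(Label.env, s)]) ∧ (endState σ l, s) ∉ r ∧
    .fin σ (l ++ [(Label.env, s)]) .incomplete ∈ c.traces

/-! ### Commands that never fail -/

/-- The command has no failing trace. -/
def Command.NoAbort (c : Command S) : Prop := ∀ t ∈ c.traces, t.NonAborted

theorem Command.NoAbort.mono {c d : Command S} (h : c.NoAbort) (hd : d ≤ c) : d.NoAbort :=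
  fun t ht => h t (hd ht)

theorem noAbort_test (p : Set S) : (test p).NoAbort := by
  rintro t ⟨σ, rfl | ⟨-, rfl⟩⟩ s l <;> simp

theorem Command.NoAbort.seq {c d : Command S} (hc : c.NoAbort) (hd : d.NoAbort) :
    (c ⨟ d).NoAbort := by
  rintro t (⟨h, -⟩ | ⟨σ, l, -, u, hu, -, rfl⟩ | ⟨σ, l, h, -⟩)
  · exact hc t h
  · intro s k h
    cases u with
    | inf _ f => simp [Trace.prepend] at h
    | fin s' m o =>
      simp only [Trace.prepend, Trace.fin.injEq] at h
      obtain ⟨-, -, rfl⟩ := h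
      exact hd _ hu _ _ rfl
  · exact absurd rfl (hc _ h _ _)

/-! ### Iteration -/

theorem iter_eq (c : Command S) : iter c = nil ⊔ c ⨟ iter c :=
  (OrderHom.map_gfp (iterFun c)).symm

theorem finIter_eq (c : Command S) : finIter c = nil ⊔ c ⨟ finIter c :=
  (OrderHom.map_lfp (iterFun c)).symm

theorem mem_iter_iff {c : Command S} {t : Trace S} :
    t ∈ (iter c).traces ↔ t ∈ (nil : Command S).traces ∨ t ∈ (c ⨟ iter c).traces := by
  conv_lhs => rw [iter_eq]
  rfl

theorem mem_finIter_iff {c : Command S} {t : Trace S} :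
    t ∈ (finIter c).traces ↔ t ∈ (nil : Command S).traces ∨ t ∈ (c ⨟ finIter c).traces := by
  conv_lhs => rw [finIter_eq]
  rfl

theorem seq_mono_left {c c' : Command S} (h : c ≤ c') (d : Command S) : c ⨟ d ≤ c' ⨟ d := by
  rintro t (⟨ht, ht'⟩ | ⟨σ, l, hc, ht⟩ | ⟨σ, l, hc, ht⟩)
  · exact .inl ⟨h ht, ht'⟩
  · exact .inr (.inl ⟨σ, l, h hc, ht⟩)
  · exact .inr (.inr ⟨σ, l, h hc, ht⟩)

/-- Coinduction for the greatest fixed point. -/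
theorem le_iter {c d : Command S} (h : d ≤ nil ⊔ c ⨟ d) : d ≤ iter c :=
  OrderHom.le_gfp (iterFun c) h

theorem iter_mono {c c' : Command S} (h : c ≤ c') : iter c ≤ iter c' :=
  le_iter ((iter_eq c).le.trans (sup_le_sup_left (seq_mono_left h _) _))

theorem finIter_le_iter (c : Command S) : finIter c ≤ iter c :=
  OrderHom.lfp_le _ (iter_eq c).ge

/-- The command makes a single transition, which satisfies `R`, and terminates. -/
def IsStep (c : Command S) (R : S → Transition S → Prop) : Prop :=
  ∀ t, t ∈ c.traces ↔ ∃ σ, t = .fin σ [] .incomplete ∨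
    ∃ a, R σ a ∧ (t = .fin σ [a] .incomplete ∨ t = .fin σ [a] .terminated)

theorem isStep_atomic (k : Label) (r : Set (S × S)) :
    IsStep (atomic k r) fun σ a => a.1 = k ∧ (σ, a.2) ∈ r := by
  intro t
  constructor
  · rintro ⟨σ, h | ⟨σ', hr, h⟩⟩
    · exact ⟨σ, .inl h⟩
    · exact ⟨σ, .inr ⟨(k, σ'), ⟨rfl, hr⟩, h⟩⟩
  · rintro ⟨σ, h | ⟨⟨_, σ'⟩, ⟨rfl, hr⟩, h⟩⟩
    · exact ⟨σ, .inl h⟩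
    · exact ⟨σ, .inr ⟨σ', hr, h⟩⟩

theorem IsStep.sup {c d : Command S} {R Q : S → Transition S → Prop} (hc : IsStep c R)
    (hd : IsStep d Q) : IsStep (c ⊔ d) fun σ a => R σ a ∨ Q σ a := by
  intro t
  change t ∈ c.traces ∨ t ∈ d.traces ↔ _
  rw [hc t, hd t]
  constructor
  · rintro (⟨σ, h | ⟨a, ha, h⟩⟩ | ⟨σ, h | ⟨a, ha, h⟩⟩)
    · exact ⟨σ, .inl h⟩
    · exact ⟨σ, .inr ⟨a, .inl ha, h⟩⟩
    · exact ⟨σ, .inl h⟩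
    · exact ⟨σ, .inr ⟨a, .inr ha, h⟩⟩
  · rintro ⟨σ, h | ⟨a, ha | ha, h⟩⟩
    · exact .inl ⟨σ, .inl h⟩
    · exact .inl ⟨σ, .inr ⟨a, ha, h⟩⟩
    · exact .inr ⟨σ, .inr ⟨a, ha, h⟩⟩

theorem IsStep.congr {c : Command S} {R Q : S → Transition S → Prop} (hc : IsStep c R)
    (h : ∀ σ a, R σ a ↔ Q σ a) : IsStep c Q := by
  obtain rfl : R = Q := funext₂ fun σ a => propext (h σ a)
  exact hc

theorem isStep_step (r : Set (S × S)) : IsStep (step r) fun σ a => (σ, a.2) ∈ r :=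
  ((isStep_atomic .prog r).sup (isStep_atomic .env r)).congr fun σ a => by
    rcases a with ⟨_ | _, s⟩ <;> simp

theorem isStep_anyStep : IsStep (anyStep : Command S) fun _ _ => True :=
  (isStep_step Set.univ).congr fun _ _ => by simp

theorem IsStep.terminated_mem {c : Command S} {R : S → Transition S → Prop} (hc : IsStep c R)
    {σ : S} {a : Transition S} (h : R σ a) : .fin σ [a] .terminated ∈ c.traces :=
  (hc _).2 ⟨σ, .inr ⟨a, h, .inr rfl⟩⟩

theorem IsStep.noAbort {c : Command S} {R : S → Transition S → Prop} (hc : IsStep c R) :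
    c.NoAbort := by
  intro t ht
  obtain ⟨σ, rfl | ⟨a, -, rfl | rfl⟩⟩ := (hc t).1 ht <;> intro s l <;> simp

/-- An observation that stops right after the transition of `c` counts as that transition followed
by the empty observation of `d`. Since `c` cannot fail, only two shapes of trace remain. -/
theorem IsStep.mem_seq_cases {c d : Command S} {R : S → Transition S → Prop} (hc : IsStep c R)
    {t : Trace S} (ht : t ∈ (c ⨟ d).traces) :
    (∃ σ, t = .fin σ [] .incomplete) ∨ ∃ (σ : S) (a : Transition S) (u : Trace S), R σ a ∧
      u ∈ d.traces ∧ u.first = a.2 ∧ t = u.prepend σ [a] := by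
  rcases ht with ⟨h, h'⟩ | ⟨σ, l, h, u, hu, hf, rfl⟩ | ⟨σ, l, h, -⟩
  · obtain ⟨σ, rfl | ⟨a, ha, rfl | rfl⟩⟩ := (hc t).1 h
    · exact .inl ⟨σ, rfl⟩
    · exact .inr ⟨σ, a, .fin a.2 [] .incomplete, ha, d.initial _, rfl, rfl⟩
    · exact absurd rfl (h' _ _)
  · obtain ⟨σ', h | ⟨a, ha, h | h⟩⟩ := (hc _).1 h <;>
      simp only [Trace.fin.injEq, reduceCtorEq, and_false] at h
    obtain ⟨rfl, rfl, -⟩ := h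
    exact .inr ⟨_, a, u, ha, hu, hf, rfl⟩
  · exact absurd rfl (hc.noAbort _ h _ _)

theorem mem_nil_iff {t : Trace S} : t ∈ (nil : Command S).traces ↔
    ∃ σ, t = .fin σ [] .incomplete ∨ t = .fin σ [] .terminated := by
  change (∃ σ, _ ∨ _ ∧ _) ↔ _
  simp

/-- The command with all non-failing traces whose transitions satisfy `R`. -/
def stepsCommand (R : S → Transition S → Prop) : Command S where
  traces := {t | t.NonAborted ∧ t.Steps R}
  initial σ := ⟨by intro s l; simp, Trace.steps_nil _ _⟩
  prefix_closed t σ l h e := ⟨by intro s k; simp, h.2.of_extends e⟩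
  abort_closed t σ l h e := absurd rfl (h.1 σ l)

/-- A failure and a transition outside `R` both show up after finitely many transitions, so they are
excluded by induction on a finite list, even for infinite traces. Conversely, a non-failing trace
with good transitions is empty or splits off a good transition and leaves a trace of the same kind,
so coinduction applies. -/
theorem IsStep.iter_eq_stepsCommand {c : Command S} {R : S → Transition S → Prop}
    (hc : IsStep c R) : iter c = stepsCommand R := by
  apply le_antisymm
  · intro t ht
    constructor
    · rintro σ l rfl
      induction l generalizing σ with
      | nil =>
        rcases mem_iter_iff.1 ht with h | h
        · simp [mem_nil_iff] at h
        · rcases hc.mem_seq_cases h with ⟨s, h⟩ | ⟨s, a, u, -, -, -, h⟩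
          · simp at h
          · cases u <;> simp [Trace.prepend] at h
      | cons b l ih =>
        rcases mem_iter_iff.1 ht with h | h
        · simp [mem_nil_iff] at h
        · rcases hc.mem_seq_cases h with ⟨s, h⟩ | ⟨s, a, u, -, hu, hf, h⟩
          · simp at h
          · cases u <;> simp only [Trace.prepend, Trace.fin.injEq, reduceCtorEq,
              List.cons_append, List.nil_append, List.cons.injEq] at h
            obtain ⟨rfl, ⟨rfl, rfl⟩, rfl⟩ := h
            exact ih _ hu
    · intro σ l a e
      induction l generalizing t σ with
      | nil =>
        rcases mem_iter_iff.1 ht with h | h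
        · obtain ⟨s, rfl | rfl⟩ := mem_nil_iff.1 h <;>
            simpa using (Trace.extends_nil_state e).2
        · rcases hc.mem_seq_cases h with ⟨s, rfl⟩ | ⟨s, b, u, hR, hu, hf, rfl⟩
          · simpa using (Trace.extends_nil_state e).2
          · obtain ⟨rfl, rfl, -⟩ := (Trace.prepend_singleton_extends_cons hf).1 e
            exact hR
      | cons b' l ih =>
        rcases mem_iter_iff.1 ht with h | h
        · obtain ⟨s, rfl | rfl⟩ := mem_nil_iff.1 h <;>
            simpa using (Trace.extends_nil_state e).2
        · rcases hc.mem_seq_cases h with ⟨s, rfl⟩ | ⟨s, b, u, hR, hu, hf, rfl⟩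
          · simpa using (Trace.extends_nil_state e).2
          · obtain ⟨rfl, rfl, e'⟩ := (Trace.prepend_singleton_extends_cons hf).1 e
            exact ih hu _ e'
  · refine le_iter fun t ht => ?_
    rcases t.eq_nil_or_prepend with ⟨σ, o, rfl⟩ | ⟨σ, a, u, hu, rfl⟩
    · refine .inl (mem_nil_iff.2 ⟨σ, ?_⟩)
      cases o with
      | terminated => exact .inr rfl
      | incomplete => exact .inl rfl
      | aborted => exact absurd rfl (ht.1 _ _)
    · obtain ⟨hR, hs⟩ := (Trace.steps_prepend_singleton hu).1 ht.2
      exact .inr (.inr (.inl ⟨σ, [a], hc.terminated_mem hR, u,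
        ⟨Trace.nonAborted_prepend ht.1, hs⟩, hu, rfl⟩))

theorem IsStep.mem_iter {c : Command S} {R : S → Transition S → Prop} (hc : IsStep c R)
    {t : Trace S} : t ∈ (iter c).traces ↔ t.NonAborted ∧ t.Steps R := by
  rw [hc.iter_eq_stepsCommand]
  rfl

theorem IsStep.noAbort_iter {c : Command S} {R : S → Transition S → Prop} (hc : IsStep c R) :
    (iter c).NoAbort :=
  fun _ h => (hc.mem_iter.1 h).1

/-! ### Guarantee -/

theorem mem_guar_iff {g : Set (S × S)} {t : Trace S} : t ∈ (guar g).traces ↔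
    t.NonAborted ∧ t.Steps fun σ a => a.1 = .prog → (σ, a.2) ∈ g :=
  (((isStep_atomic .prog g).sup (isStep_atomic .env Set.univ)).congr fun σ a => by
    rcases a with ⟨_ | _, s⟩ <;> simp).mem_iter

theorem noAbort_guar (g : Set (S × S)) : (guar g).NoAbort := fun _ h => (mem_guar_iff.1 h).1

/-! ### Rely -/

/-- The branch without `abort` already iterates arbitrary transitions. -/
theorem mem_rely_of_nonAborted (r : Set (S × S)) {t : Trace S} (h : t.NonAborted) :
    t ∈ (rely r).traces :=
  iter_mono (le_sup_left : anyStep ≤ anyStep ⊔ envStep rᶜ ⨟ abort)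
    (isStep_anyStep.mem_iter.2 ⟨h, t.steps_true⟩)

theorem aborted_mem_rely {r : Set (S × S)} {σ s : S} {l : List (Transition S)}
    (h : (endState σ l, s) ∉ r) :
    .fin σ (l ++ [(Label.env, s)]) .aborted ∈ (rely r).traces := by
  induction l generalizing σ with
  | nil =>
    -- The loop body itself fails here, so the trace enters the composition as an unterminated trace
    -- of its first component.
    refine mem_iter_iff.2 (.inr (.inl ⟨.inr (.inr (.inl ⟨σ, [(.env, s)], ?_,
      .fin s [] .aborted, trivial, rfl, rfl⟩)), by simp⟩))
    exact (isStep_atomic .env rᶜ).terminated_mem ⟨rfl, h⟩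
  | cons a l ih =>
    exact mem_iter_iff.2 (.inr (.inr (.inl ⟨σ, [a],
      .inl (isStep_anyStep.terminated_mem trivial), _, ih h, rfl, rfl⟩)))

theorem mem_envStep_seq_cases {r : Set (S × S)} {d : Command S} {t : Trace S}
    (h : t ∈ (envStep r ⨟ d).traces) : (∃ σ, t = .fin σ [] .incomplete) ∨
      ∃ σ s, (σ, s) ∈ r ∧ t.Extends σ [(Label.env, s)] := by
  rcases (isStep_atomic .env r).mem_seq_cases h with h | ⟨σ, ⟨_, s⟩, u, ⟨rfl, hr⟩, -, hu, rfl⟩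
  · exact .inl h
  · exact .inr ⟨σ, s, hr, u, hu, rfl⟩

/-- Separates the two branches of the loop body: once the violating branch has made its transition,
`abort` absorbs whatever follows, and `d` no longer matters. -/
theorem mem_rely_body_seq_cases {r : Set (S × S)} {d : Command S} {t : Trace S}
    (h : t ∈ ((anyStep ⊔ envStep rᶜ ⨟ abort) ⨟ d).traces) :
    t ∈ (anyStep ⨟ d).traces ∨ ∃ σ s, (σ, s) ∉ r ∧ t.Extends σ [(Label.env, s)] := by
  rcases h with ⟨h | h, h'⟩ | ⟨σ, l, h | h, u, hu, hf, rfl⟩ | ⟨σ, l, h | h, e⟩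
  · exact .inl (.inl ⟨h, h'⟩)
  -- The empty observation shows no violation, but it belongs to every command and so fits the first
  -- alternative.
  · exact (mem_envStep_seq_cases h).imp_left fun ⟨σ, h⟩ => h ▸ Command.initial _ _
  · exact .inl (.inr (.inl ⟨σ, l, h, u, hu, hf, rfl⟩))
  · rcases mem_envStep_seq_cases h with ⟨σ, h⟩ | ⟨σ', s, hr, e⟩
    · simp at h
    · exact .inr ⟨σ', s, hr, Trace.Extends.trans ⟨u, hf, rfl⟩ e⟩
  · exact .inl (.inr (.inr ⟨σ, l, h, e⟩))
  · rcases mem_envStep_seq_cases h with ⟨σ, h⟩ | ⟨σ', s, hr, e'⟩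
    · simp at h
    · exact .inr ⟨σ', s, hr, e.trans e'⟩

theorem Trace.extends_fin_iff {σ σ' : S} {l m : List (Transition S)} {o : Outcome} :
    (Trace.fin σ m o).Extends σ' l ↔ σ = σ' ∧ l <+: m := by
  constructor
  · rintro ⟨u, -, h⟩
    cases u <;> simp only [Trace.prepend, Trace.fin.injEq, reduceCtorEq] at h
    exact ⟨h.1, _, h.2.1.symm⟩
  · rintro ⟨rfl, k, rfl⟩
    exact Trace.extends_append_fin _ _ _ _

/-- Either the first transition breaks `r`, or an unrestricted step was taken and the failure lies
in the rest, which is shorter. The violation sits in a prefix of `m` only, because after it anything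
may happen before the recorded failure. -/
theorem exists_of_aborted_mem_rely {r : Set (S × S)} {σ : S} {m : List (Transition S)}
    (h : .fin σ m .aborted ∈ (rely r).traces) :
    ∃ l s, l ++ [(Label.env, s)] <+: m ∧ (endState σ l, s) ∉ r := by
  induction m generalizing σ with
  | nil =>
    rcases mem_iter_iff.1 h with h | h
    · simp [mem_nil_iff] at h
    rcases mem_rely_body_seq_cases h with h | ⟨σ', s, hr, e⟩
    · rcases isStep_anyStep.mem_seq_cases h with ⟨s, h⟩ | ⟨s, a, u, -, -, -, h⟩
      · simp at h
      · cases u <;> simp [Trace.prepend] at h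
    · obtain ⟨rfl, hm⟩ := Trace.extends_fin_iff.1 e
      exact ⟨[], s, hm, hr⟩
  | cons b m ih =>
    rcases mem_iter_iff.1 h with h | h
    · simp [mem_nil_iff] at h
    rcases mem_rely_body_seq_cases h with h | ⟨σ', s, hr, e⟩
    · rcases isStep_anyStep.mem_seq_cases h with ⟨s, h⟩ | ⟨s, a, u, -, hu, hf, h⟩
      · simp at h
      · cases u <;> simp only [Trace.prepend, Trace.fin.injEq, reduceCtorEq,
          List.cons_append, List.nil_append, List.cons.injEq] at h
        obtain ⟨rfl, ⟨rfl, rfl⟩, rfl⟩ := h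
        obtain rfl : _ = b.2 := hf
        obtain ⟨l, s, hl, hr⟩ := ih hu
        exact ⟨b :: l, s, List.cons_prefix_cons.2 ⟨rfl, hl⟩, hr⟩
    · obtain ⟨rfl, hm⟩ := Trace.extends_fin_iff.1 e
      exact ⟨[], s, hm, hr⟩

/-! ### Specification -/

theorem terminated_mem_finIter_anyStep (σ : S) (l : List (Transition S)) :
    .fin σ l .terminated ∈ (finIter anyStep : Command S).traces := by
  induction l generalizing σ with
  | nil => exact mem_finIter_iff.2 (.inl (mem_nil_iff.2 ⟨σ, .inr rfl⟩))
  | cons a l ih =>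
    exact mem_finIter_iff.2 (.inr (.inr (.inl ⟨σ, [a],
      isStep_anyStep.terminated_mem trivial, _, ih a.2, rfl, rfl⟩)))

theorem noAbort_term : (term : Command S).NoAbort :=
  (isStep_anyStep.noAbort_iter.mono (finIter_le_iter _)).seq
    (isStep_atomic .env Set.univ).noAbort_iter

/-- The finite iteration performs all of `l`, and the trailing environment iteration makes no
transition. -/
theorem terminated_mem_term (σ : S) (l : List (Transition S)) :
    .fin σ l .terminated ∈ (term : Command S).traces :=
  .inr (.inl ⟨σ, l, terminated_mem_finIter_anyStep σ l, .fin (endState σ l) [] .terminated,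
    mem_iter_iff.2 (.inl (mem_nil_iff.2 ⟨_, .inr rfl⟩)), rfl, by simp [Trace.prepend]⟩)

/-- Apart from empty observations, a trace passes only the test of its own initial state, so a
single member of the join is relevant. -/
theorem mem_spec_iff {q : Set (S × S)} {t : Trace S} :
    t ∈ (spec q).traces ↔ t ∈ (term ⨟ test {σ | (t.first, σ) ∈ q}).traces := by
  constructor
  · rintro (⟨σ, rfl⟩ | ⟨c, ⟨σ₀, rfl⟩, h⟩)
    · exact Command.initial _ _
    · rcases h with ⟨⟨σ, rfl | ⟨-, rfl⟩⟩, h⟩ | ⟨σ, l, ⟨σ', h⟩, u, hu, hf, rfl⟩ | ⟨σ, l, h, -⟩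
      · exact Command.initial _ _
      · exact absurd rfl (h _ _)
      · simp only [Trace.fin.injEq, reduceCtorEq, and_false, false_or, and_true,
          Set.mem_singleton_iff] at h
        obtain ⟨rfl, rfl, rfl⟩ := h
        change u.first = σ at hf
        subst hf
        rwa [u.prepend_nil]
      · exact absurd rfl (noAbort_test _ _ h _ _)
  · intro h
    exact .inr ⟨_, ⟨t.first, rfl⟩, .inr (.inl ⟨t.first, [], ⟨_, .inr ⟨rfl, rfl⟩⟩, t, h, rfl,
      t.prepend_nil.symm⟩)⟩

theorem noAbort_spec (q : Set (S × S)) : (spec q).NoAbort := fun _ h =>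
  noAbort_term.seq (noAbort_test _) _ (mem_spec_iff.1 h)

/-- The final test acts only at termination. Hence a specification never prevents a weak conjunction
from failing through its other conjunct. -/
theorem incomplete_mem_spec (q : Set (S × S)) (σ : S) (l : List (Transition S)) :
    .fin σ l .incomplete ∈ (spec q).traces :=
  mem_spec_iff.2 (.inl ⟨term.prefix_closed _ _ _ (terminated_mem_term σ l)
    (Trace.extends_self _ _ _), by simp⟩)

/-- Only the terminated traces of a specification depend on the postcondition. -/
theorem mem_spec_of_mem_spec {q q' : Set (S × S)} {t : Trace S} (h : t ∈ (spec q).traces)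
    (hq : ∀ σ l, t = .fin σ l .terminated → (σ, endState σ l) ∈ q → (σ, endState σ l) ∈ q') :
    t ∈ (spec q').traces := by
  rw [mem_spec_iff] at h ⊢
  rcases h with h | ⟨σ, l, h, u, ⟨s, hu⟩, hf, rfl⟩ | h
  · exact .inl h
  · refine .inr (.inl ⟨σ, l, h, u, ⟨s, ?_⟩, hf, rfl⟩)
    rcases hu with rfl | ⟨hs, rfl⟩
    · exact .inl rfl
    · change s = endState σ l at hf
      subst hf
      exact .inr ⟨hq σ l (by simp [Trace.prepend]) hs, rfl⟩
  · exact .inr (.inr h)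

/-! ### Assertions and invariants -/

theorem aborted_mem_assertion_seq {p : Set S} {σ : S} (h : σ ∉ p) (c : Command S) :
    .fin σ [] .aborted ∈ (assertion p ⨟ c).traces :=
  .inl ⟨.inr (.inr (.inl ⟨σ, [], ⟨σ, .inr ⟨h, rfl⟩⟩, .fin σ [] .aborted, trivial, rfl, rfl⟩)),
    by simp⟩

theorem mem_assertion_seq_of_mem {p : Set S} {c : Command S} {t : Trace S} (h : t ∈ c.traces) :
    t ∈ (assertion p ⨟ c).traces :=
  .inr (.inl ⟨t.first, [], .inl (mem_nil_iff.2 ⟨_, .inr rfl⟩), t, h, rfl,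
    t.prepend_nil.symm⟩)

/-- From a state in `p` the test of the complement is infeasible, so the failing branch contributes
only the empty observation. -/
theorem first_mem_assertion {p : Set S} {t : Trace S} (h : t ∈ (assertion p).traces)
    (hp : t.first ∈ p) : t ∈ (nil : Command S).traces := by
  rcases h with h | h
  · exact h
  · rcases h with ⟨⟨σ, rfl | ⟨-, rfl⟩⟩, h⟩ | ⟨σ, l, ⟨σ', h⟩, u, -, -, rfl⟩ | ⟨σ, l, h, -⟩
    · exact Command.initial _ _
    · exact absurd rfl (h _ _)
    · simp only [Trace.fin.injEq, reduceCtorEq, and_false, false_or, and_true] at h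
      obtain ⟨hs, rfl, -⟩ := h
      rw [Trace.first_prepend] at hp
      exact absurd hp hs
    · exact absurd rfl (noAbort_test _ _ h _ _)

theorem mem_of_mem_assertion_seq {p : Set S} {c : Command S} {t : Trace S}
    (h : t ∈ (assertion p ⨟ c).traces) (hp : t.first ∈ p) : t ∈ c.traces := by
  rcases h with ⟨h, h'⟩ | ⟨σ, l, h, u, hu, hf, rfl⟩ | ⟨σ, l, h, e⟩
  · obtain ⟨σ, rfl | rfl⟩ := mem_nil_iff.1 (first_mem_assertion h hp)
    · exact c.initial _
    · exact absurd rfl (h' _ _)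
  · rw [Trace.first_prepend] at hp
    obtain ⟨s, h | h⟩ := mem_nil_iff.1 (first_mem_assertion h hp) <;>
      simp only [Trace.fin.injEq, reduceCtorEq, and_false] at h
    obtain ⟨rfl, rfl, -⟩ := h
    change u.first = σ at hf
    subst hf
    rwa [u.prepend_nil]
  · have := first_mem_assertion h (e.first_eq ▸ hp)
    simp [mem_nil_iff] at this

theorem mem_inv {I : Set S} {t : Trace S} (h : t ∈ (inv I).traces) (hI : t.first ∈ I) :
    t.NonAborted ∧ t.Steps fun _ a => a.2 ∈ I :=
  (isStep_step _).mem_iter.1 (mem_of_mem_assertion_seq h hI)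

/-- The state reached is either the initial state or the post-state of the last transition. -/
theorem Trace.Steps.endState_mem {I : Set S} {t : Trace S} (h : t.Steps fun _ a => a.2 ∈ I)
    (hI : t.first ∈ I) {σ : S} {l : List (Transition S)} (e : t.Extends σ l) :
    endState σ l ∈ I := by
  rcases l.eq_nil_or_concat with rfl | ⟨l, a, rfl⟩
  · exact e.first_eq ▸ hI
  · rw [List.concat_eq_append] at e ⊢
    rw [endState_append]
    exact h _ _ _ e

/-- A trace whose states satisfy `I` keeps a guarantee if it keeps one that is stronger
on `I`. -/
theorem mem_guar_of_mem_guar {I : Set S} {g g' : Set (S × S)}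
    (hg : g ⊇ preRel I ∩ g' ∩ postRel I) {t : Trace S} (h : t.Steps fun _ a => a.2 ∈ I)
    (hI : t.first ∈ I) (ht : t ∈ (guar g').traces) : t ∈ (guar g).traces := by
  rw [mem_guar_iff] at ht ⊢
  exact ⟨ht.1, fun σ l a e ha =>
    hg ⟨⟨h.endState_mem hI e.of_append, ht.2 σ l a e ha⟩, h _ _ _ e⟩⟩

/-! ### Weak conjunction -/

theorem mem_conj_of_aborted_left {c d : Command S} {t : Trace S} {σ : S}
    {l : List (Transition S)} (e : t.Extends σ l) (hc : .fin σ l .aborted ∈ c.traces)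
    (hd : .fin σ l .incomplete ∈ d.traces) : t ∈ (c ⋒ d).traces :=
  .inr ⟨σ, l, e, .inl ⟨hc, hd⟩⟩

theorem mem_conj_of_aborted_right {c d : Command S} {t : Trace S} {σ : S}
    {l : List (Transition S)} (e : t.Extends σ l) (hc : .fin σ l .incomplete ∈ c.traces)
    (hd : .fin σ l .aborted ∈ d.traces) : t ∈ (c ⋒ d).traces :=
  .inr ⟨σ, l, e, .inr ⟨hc, hd⟩⟩

theorem Trace.Violates.of_extends {r : Set (S × S)} {c : Command S} {t : Trace S} {σ : S}
    {l : List (Transition S)} {o : Outcome} (h : (Trace.fin σ l o).Violates r c)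
    (e : t.Extends σ l) : t.Violates r c := by
  obtain ⟨s, m, s', e', h⟩ := h
  exact ⟨s, m, s', e.trans e', h⟩

/-- Under a conjunct that does not fail, a rely command only fails after a violation. -/
theorem mem_rely_conj_cases {r : Set (S × S)} {c : Command S} (hc : c.NoAbort) {t : Trace S}
    (h : t ∈ (rely r ⋒ c).traces) : t ∈ c.traces ∨ t.Violates r c := by
  rcases h with ⟨-, h⟩ | ⟨σ, l, e, ⟨h, h'⟩ | ⟨-, h⟩⟩
  · exact .inl h
  · obtain ⟨m, s, hm, hr⟩ := exists_of_aborted_mem_rely h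
    have e' : (Trace.fin σ l .incomplete).Extends σ (m ++ [(Label.env, s)]) :=
      Trace.extends_fin_iff.2 ⟨rfl, hm⟩
    exact .inr ⟨σ, m, s, e.trans e', hr, c.prefix_closed _ _ _ h' e'⟩
  · exact absurd rfl (hc _ h _ _)

end RelyGuarantee

open RelyGuarantee
theorem mainTheorem5 {S : Type*} (I p₁ p₂ : Set S) (r₁ r₂ g₁ g₂ q₁ q₂ : Set (S × S))
    (hp : I ∩ p₁ ⊆ p₂)
    (hr : preRel I ∩ r₁ ∩ postRel I ⊆ r₂)
    (hg : g₁ ⊇ preRel I ∩ g₂ ∩ postRel I)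
    (hq : q₁ ⊇ preRel I ∩ preRel p₁ ∩ q₂ ∩ postRel I) :
    DataReifies I
      (rely r₁ ⋒ guar g₁ ⋒ assertion p₁ ⨟ spec q₁)
      (rely r₂ ⋒ guar g₂ ⋒ assertion p₂ ⨟ spec q₂) := by
  intro t ht
  have e₀ : t.Extends t.first [] := Trace.extends_nil_iff.2 rfl
  by_cases hI : t.first ∈ I
  swap
  · exact mem_conj_of_aborted_left e₀ (aborted_mem_assertion_seq hI _) (Command.initial _ _)
  by_cases hp₁ : t.first ∈ p₁
  swap
  -- The assertion of `p₁` fails before any transition, and every other conjunct has the empty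
  -- observation.
  · exact mem_conj_of_aborted_right e₀ (Command.initial _ _)
      (mem_conj_of_aborted_right (Trace.extends_self _ _ _) (Command.initial _ _)
        (aborted_mem_assertion_seq hp₁ _))
  have hp₂ : t.first ∈ p₂ := hp ⟨hI, hp₁⟩
  -- From a state in `p₂` a broken rely is the only source of failure. Membership in `rely r₂` can
  -- be dropped otherwise, since `rely r₁` admits every non-failing trace.
  have violates {u : Trace S} (hu : u ∈ (rely r₂ ⋒ guar g₂ ⋒ assertion p₂ ⨟ spec q₂).traces)
      (huf : u.first = t.first) : u.Violates r₂ (guar g₂) ∨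
        u ∈ (guar g₂).traces ∧ u ∈ (spec q₂).traces := by
    rcases hu with ⟨h, h'⟩ | ⟨σ, l, e, ⟨h, -⟩ | ⟨-, h⟩⟩
    · exact (mem_rely_conj_cases (noAbort_guar g₂) h).symm.imp_right fun h =>
        ⟨h, mem_of_mem_assertion_seq h' (huf ▸ hp₂)⟩
    · rcases mem_rely_conj_cases (noAbort_guar g₂) h with h | h
      · exact absurd rfl (noAbort_guar g₂ _ h _ _)
      · exact .inl (h.of_extends e)
    · refine absurd rfl (noAbort_spec q₂ _ (mem_of_mem_assertion_seq h ?_) _ _)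
      exact e.first_eq ▸ huf ▸ hp₂
  -- Failure after a violated rely carries over to the reified command.
  have transfer {u : Trace S} (hu : u ∈ (inv I).traces)
      (e : ∀ σ l, u.Extends σ l → t.Extends σ l) (hv : u.Violates r₂ (guar g₂)) :
      t ∈ (inv I ⋒ (rely r₁ ⋒ guar g₁ ⋒ assertion p₁ ⨟ spec q₁)).traces := by
    obtain ⟨σ, m, s, e', hs, hm⟩ := hv
    have hi := (inv I).prefix_closed _ _ _ hu e'
    have hσ : σ ∈ I := (e _ _ e').first_eq ▸ hI
    obtain ⟨-, hS⟩ := mem_inv hi hσ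
    have hs' : (endState σ m, s) ∉ r₁ := fun h => hs (hr ⟨⟨hS.endState_mem hσ
      (Trace.extends_append_fin _ _ _ _), h⟩, hS _ _ _ (Trace.extends_self _ _ _)⟩)
    -- At the offending transition `rely r₁` fails while the guarantee, the specification and the
    -- invariant have the same transitions as an incomplete trace; the failure passes through the
    -- three nested conjunctions.
    refine mem_conj_of_aborted_right (e _ _ e') hi ?_
    refine mem_conj_of_aborted_left (Trace.extends_self _ _ _) ?_
      (mem_assertion_seq_of_mem (incomplete_mem_spec _ _ _))
    exact mem_conj_of_aborted_left (Trace.extends_self _ _ _) (aborted_mem_rely hs')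
      (mem_guar_of_mem_guar hg hS hσ hm)
  rcases ht with ⟨h, h'⟩ | ⟨σ, l, e, ⟨h, -⟩ | ⟨h, h'⟩⟩
  · obtain ⟨hN, hS⟩ := mem_inv h hI
    rcases violates h' rfl with hv | ⟨hgt, hqt⟩
    · exact transfer h (fun _ _ => id) hv
    · refine .inl ⟨h, .inl ⟨.inl ⟨mem_rely_of_nonAborted _ hN,
        mem_guar_of_mem_guar hg hS hI hgt⟩,
        mem_assertion_seq_of_mem (mem_spec_of_mem_spec hqt ?_)⟩⟩
      rintro σ l rfl hσ
      exact hq ⟨⟨⟨hI, hp₁⟩, hσ⟩, hS.endState_mem hI (Trace.extends_self _ _ _)⟩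
  · exact absurd rfl ((mem_inv h (e.first_eq ▸ hI)).1 _ _)
  -- Here `t` continues a failure of the reified command. The violation is found in the failing
  -- trace and then moved to the incomplete trace with the same transitions, which is the one known
  -- to belong to `inv I`.
  · rcases violates h' e.first_eq.symm with hv | ⟨hgt, -⟩
    · exact transfer h (fun _ _ => e.trans) (hv.of_extends (Trace.extends_self _ _ _))
    · exact absurd rfl (noAbort_guar g₂ _ hgt _ _)
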